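/- Let $n>k\ge r\ge 1$ be integers. An $(n,k,r)$-LRC is a $k$-dimensional linear code of length $n$ over some finite field in which every coordinate of a codeword is a fixed linear combination of at most $r$ other coordinates. Assume $\frac{k}{n}\le\frac{r}{r+1}$ (a condition that the parameters of every $(n,k,r)$-LRC satisfy). Let $\mathscr{D}(n,k,r)$ be the largest minimum Hamming distance among all $(n,k,r)$-LRCs, over all finite fields, and put $$d^*=n-k-\left\lceil \tfrac{k}{r}\right\rceil+2,\quad k_1=\left\lceil \tfrac{k}{r}\right\rceil,\quad k_2=k_1r-k,\quad n_1=\left\lceil \tfrac{n}{r+1}\right\rceil,\quad n_2=n_1(r+1)-n.$$ Suppose $k_2=\binom{k_1}{2}-1$ (so that $k_1\ge 2$). If $n_2\le t_{k_1-1}(n_1)$, where $t_p(m)$ denotes the number of edges of the Turán graph on $m$ vertices with $p$ parts (the complete $p$-partite graph on $m$ vertices whose part sizes differ by at most one), then the maximum $\mathscr{D}(n,k,r)$ exists and $\mathscr{D}(n,k,r)=d^*$. -/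

import Mathlib

namespace LRC

open Classical in
/-- The minimum (Hamming) distance of a linear code: the least distance between two distinct
codewords. It is used only for codes of positive dimension, where the set is nonempty. -/
noncomputable def minDist {F : Type} [Field F] {n : ℕ} (C : Submodule F (Fin n → F)) : ℕ :=
  sInf {d | ∃ x ∈ C, ∃ y ∈ C, x ≠ y ∧ hammingDist x y = d}

/-- All-symbol locality `r`: every coordinate of a codeword is recovered by a fixed linear
combination of at most `r` other coordinates. -/
def HasLocality {F : Type} [Field F] {n : ℕ} (C : Submodule F (Fin n → F)) (r : ℕ) : Prop :=
  ∀ i : Fin n, ∃ R : Finset (Fin n), i ∉ R ∧ R.card ≤ r ∧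
    ∃ a : Fin n → F, ∀ c ∈ C, c i = ∑ j ∈ R, a j * c j

/-- `C` is an `(n, k, r)`-LRC: a linear code of length `n`, dimension `k` and locality `r`. -/
structure IsLRC {F : Type} [Field F] {n : ℕ} (C : Submodule F (Fin n → F)) (k r : ℕ) : Prop where
  finrank_eq : Module.finrank F C = k
  locality : HasLocality C r

/-- The minimum distances of all `(n, k, r)`-LRCs, over all finite fields. -/
def lrcMinDists (n k r : ℕ) : Set ℕ :=
  {d | ∃ (F : Type) (_ : Field F) (_ : Finite F) (C : Submodule F (Fin n → F)),
    IsLRC C k r ∧ minDist C = d}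

/-- `𝒟(n, k, r)`: the largest possible minimum distance among all `(n, k, r)`-LRCs. -/
noncomputable def largestMinDist (n k r : ℕ) : ℕ := sSup (lrcMinDists n k r)

/-- The Singleton-like bound `d* = n - k - ⌈k / r⌉ + 2`. -/
def dStar (n k r : ℕ) : ℤ := (n : ℤ) - k - ⌈(k : ℚ) / r⌉ + 2

/-- `k₁ = ⌈k / r⌉`. -/
def k₁ (k r : ℕ) : ℕ := ⌈(k : ℚ) / r⌉₊

/-- `k₂ = k₁ r - k`. -/
def k₂ (k r : ℕ) : ℤ := (k₁ k r : ℤ) * r - k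

/-- `n₁ = ⌈n / (r + 1)⌉`. -/
def n₁ (n r : ℕ) : ℕ := ⌈(n : ℚ) / (r + 1)⌉₊

/-- `n₂ = n₁ (r + 1) - n`. -/
def n₂ (n r : ℕ) : ℤ := (n₁ n r : ℤ) * (r + 1) - n

/-- `t_p(m)`: the number of edges of the Turán graph on `m` vertices with `p` parts. -/
def turanSize (p m : ℕ) : ℕ := (SimpleGraph.turanGraph m p).edgeFinset.card

end LRC

/-! Upper bound: while the subcode vanishing on `T` is nonzero, adjoin to `T` a coordinate it does
not kill, together with its recovery set. Each round costs at most `r` dimensions and gives one free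
zero, so `k₁ - 1` rounds improve the Singleton bound by `k₁ - 1`.

Attaining it: take a graph with `n₁` vertices and `n₂` edges and no `k₁`-clique, inside a Turán
graph. Vertices are local checks on at most `r + 1` coordinates; each edge is one coordinate shared
by its two ends, which leaves `n₁ (r + 1) - n₂ = n` coordinates. Over a large field a generic
`k`-dimensional subspace of the kernel is optimal once every `T` supporting `k₁` independent check
combinations has at least `k + k₁` elements (`exists_isLRC_le_minDist`). This is a count
(`le_card_of_le_finrank_rowsWithin`): `k₁` vertices span fewer than `k₁.choose 2` edges, exactly
what the value of `k₂` demands, and larger vertex sets have room to spare because `n₂ ≤ r`. -/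

open Finset Module

namespace LRC

/-! ### Dimensions of subcodes vanishing on a coordinate set. -/

section Vanishing

variable {F ι : Type*} [Field F]

/-- The vectors of `D` whose coordinates in `T` vanish. -/
def vanishOn (D : Submodule F (ι → F)) (T : Finset ι) : Submodule F (ι → F) :=
  D ⊓ Submodule.pi (T : Set ι) fun _ => ⊥

theorem mem_vanishOn {D : Submodule F (ι → F)} {T : Finset ι} {x : ι → F} :
    x ∈ vanishOn D T ↔ x ∈ D ∧ ∀ i ∈ T, x i = 0 := by
  simp [vanishOn, Submodule.mem_pi]

theorem exists_ne_zero_of_finrank_vanishOn_pos {D : Submodule F (ι → F)} {T : Finset ι}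
    (h : 0 < finrank F (vanishOn D T)) : ∃ c ∈ vanishOn D T, c ≠ 0 := by
  by_contra! hc
  rw [(Submodule.eq_bot_iff _).2 hc, finrank_bot] at h
  omega

variable [Fintype ι]

theorem finrank_le_finrank_vanishOn_add_card (D : Submodule F (ι → F)) (Q : Finset ι) :
    finrank F D ≤ finrank F (vanishOn D Q) + #Q := by
  let f : D →ₗ[F] (Q → F) :=
    LinearMap.pi fun i => (LinearMap.proj (i : ι)).comp D.subtype
  have h1 := f.finrank_range_add_finrank_ker
  have h2 : finrank F (LinearMap.range f) ≤ #Q := by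
    simpa using Submodule.finrank_le (LinearMap.range f)
  have h3 : finrank F (LinearMap.ker f) ≤ finrank F (vanishOn D Q) := by
    rw [← Submodule.finrank_map_subtype_eq D (LinearMap.ker f)]
    apply Submodule.finrank_mono
    rintro _ ⟨x, hx, rfl⟩
    refine mem_vanishOn.2 ⟨x.2, fun i hi => ?_⟩
    exact congrFun (LinearMap.mem_ker.1 hx) ⟨i, hi⟩
  omega

theorem finrank_le_card_of_forall_eq_zero (D : Submodule F (ι → F)) (Q : Finset ι)
    (h : ∀ y ∈ D, (∀ i ∈ Q, y i = 0) → y = 0) : finrank F D ≤ #Q := by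
  have h1 := finrank_le_finrank_vanishOn_add_card D Q
  have h2 : vanishOn D Q = ⊥ := by
    rw [Submodule.eq_bot_iff]
    exact fun x hx => h x (mem_vanishOn.1 hx).1 (mem_vanishOn.1 hx).2
  rw [h2, finrank_bot] at h1
  omega

theorem finrank_vanishOn_le_add_card_sdiff [DecidableEq ι] (D : Submodule F (ι → F))
    (T R : Finset ι) :
    finrank F (vanishOn D T) ≤ finrank F (vanishOn D (T ∪ R)) + #(R \ T) := by
  have h : vanishOn (vanishOn D T) (R \ T) = vanishOn D (T ∪ R) := by
    ext x
    simp only [mem_vanishOn, mem_sdiff, mem_union, and_assoc]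
    refine and_congr_right fun _ => ⟨fun h i hi => ?_, fun h => ⟨fun i hi => h i (.inl hi),
      fun i hi => h i (.inr hi.1)⟩⟩
    by_cases hT : i ∈ T
    · exact h.1 i hT
    · exact h.2 i ⟨hi.resolve_left hT, hT⟩
  rw [← h]
  exact finrank_le_finrank_vanishOn_add_card _ _

end Vanishing

/-! ### The Singleton-like upper bound. -/

section Singleton

variable {F : Type} [Field F] {n : ℕ}

theorem minDist_le_of_mem {C : Submodule F (Fin n → F)} {c : Fin n → F} (hc : c ∈ C)
    (h0 : c ≠ 0) {T : Finset (Fin n)} (hT : ∀ i ∈ T, c i = 0) : minDist C + #T ≤ n := by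
  classical
  have h1 : minDist C ≤ hammingDist c 0 := Nat.sInf_le ⟨c, hc, 0, C.zero_mem, h0, by congr!⟩
  have h2 : hammingDist c 0 + #T ≤ n := by
    have hd : Disjoint ({i | c i ≠ (0 : Fin n → F) i} : Finset (Fin n)) T := by
      rw [Finset.disjoint_left]
      intro i hi hiT
      simp only [mem_filter] at hi
      exact hi.2 (hT i hiT)
    have := card_le_univ (({i | c i ≠ (0 : Fin n → F) i} : Finset (Fin n)) ∪ T)
    rw [card_union_of_disjoint hd, Fintype.card_fin] at this
    exact this
  omega

/-- Invariants of the greedy choice: dimension plus cardinality grows by one per round, since `i`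
vanishes once `R` does; the second bound keeps the dimension positive for the next round. -/
theorem exists_card_le_finrank_vanishOn {C : Submodule F (Fin n → F)} {k r : ℕ} (hC : IsLRC C k r)
    (t : ℕ) (ht : ∀ s < t, s * r < k) :
    ∃ T : Finset (Fin n), k + t ≤ finrank F (vanishOn C T) + #T ∧
      k ≤ finrank F (vanishOn C T) + t * r := by
  induction t with
  | zero =>
    have : vanishOn C ∅ = C := by ext; simp [mem_vanishOn]
    exact ⟨∅, by rw [this, hC.finrank_eq]; simp, by rw [this, hC.finrank_eq]; simp⟩
  | succ t ih =>
    obtain ⟨T, h1, h2⟩ := ih fun s hs => ht s (by omega)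
    have h3 := ht t (by omega)
    obtain ⟨c, hc, hc0⟩ := exists_ne_zero_of_finrank_vanishOn_pos
      (D := C) (T := T) (by omega)
    obtain ⟨i, hi⟩ := Function.ne_iff.1 hc0
    obtain ⟨R, hiR, hRr, a, ha⟩ := hC.locality i
    have hiT : i ∉ T := fun h => hi ((mem_vanishOn.1 hc).2 i h)
    have hZ : vanishOn C (insert i (T ∪ R)) = vanishOn C (T ∪ R) := by
      ext x
      simp only [mem_vanishOn, mem_insert, forall_eq_or_imp]
      refine and_congr_right fun hx => and_iff_right_of_imp fun h => ?_
      rw [ha x hx]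
      exact sum_eq_zero fun j hj => by rw [h j (mem_union_right _ hj), mul_zero]
    have h4 := finrank_vanishOn_le_add_card_sdiff C T R
    have h5 : #(insert i (T ∪ R)) = #T + #(R \ T) + 1 := by
      rw [card_insert_of_notMem (by simp [hiT, hiR]), ← union_sdiff_self_eq_union,
        card_union_of_disjoint disjoint_sdiff]
    have h6 : #(R \ T) ≤ #R := card_le_card sdiff_subset
    refine ⟨insert i (T ∪ R), ?_, ?_⟩
    · rw [hZ, h5]; omega
    · rw [hZ, add_mul, one_mul]; omega

/-- The Singleton-like bound for locally repairable codes. -/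
theorem IsLRC.minDist_add_le {C : Submodule F (Fin n → F)} {k r t : ℕ} (hC : IsLRC C k r)
    (ht : t * r < k) : minDist C + k + t ≤ n + 1 := by
  obtain ⟨T, h1, h2⟩ := exists_card_le_finrank_vanishOn hC t
    fun s hs => (Nat.mul_le_mul_right r hs.le).trans_lt ht
  have h3 : finrank F (vanishOn C T) ≤ #(Tᶜ) :=
    finrank_le_card_of_forall_eq_zero _ _ fun y hy h => funext fun i => by
      by_cases hi : i ∈ T
      · exact (mem_vanishOn.1 hy).2 i hi
      · exact h i (mem_compl.2 hi)
  -- Padding by one coordinate fewer than the remaining dimension leaves a nonzero codeword.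
  obtain ⟨S, hS, hSc⟩ := exists_subset_card_eq
    (show finrank F (vanishOn C T) - 1 ≤ #(Tᶜ) by omega)
  have h4 := finrank_vanishOn_le_add_card_sdiff C T S
  have hd : Disjoint T S := (disjoint_compl_right (a := T)).mono_right hS
  rw [sdiff_eq_self_of_disjoint hd.symm] at h4
  obtain ⟨c, hc, hc0⟩ := exists_ne_zero_of_finrank_vanishOn_pos
    (D := C) (T := T ∪ S) (by omega)
  have h5 := minDist_le_of_mem (mem_vanishOn.1 hc).1 hc0 (mem_vanishOn.1 hc).2
  rw [card_union_of_disjoint hd] at h5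
  omega

end Singleton

/-! ### Generic subspaces over large finite fields. -/

section Generic

variable {F E τ : Type*} [Field F] [Finite F] [AddCommGroup E] [Module F E]
  [FiniteDimensional F E] [Fintype τ]

/-- With `q = Nat.card F`, fewer than `q` sets of at most `q ^ (finrank F V - 1)` elements cannot
cover `V`. -/
theorem exists_mem_forall_notMem_of_finrank_lt (V : Submodule F E) (W : τ → Submodule F E)
    (h : ∀ t, finrank F (W t) < finrank F V) (hq : Fintype.card τ < Nat.card F) :
    ∃ v ∈ V, ∀ t, v ∉ W t := by
  classical
  by_contra! hc
  have : Finite E := Module.finite_of_finite F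
  have := Fintype.ofFinite E
  have hcard : ∀ X : Submodule F E, #({x | x ∈ X} : Finset E) = Nat.card F ^ finrank F X := by
    intro X
    rw [← Module.natCard_eq_pow_finrank (K := F) (V := X), Nat.card_eq_fintype_card,
      Fintype.card_subtype]
  have hsub : ({x | x ∈ V} : Finset E) ⊆ univ.biUnion fun t => ({x | x ∈ W t} : Finset E) := by
    intro x hx
    obtain ⟨t, ht⟩ := hc x (mem_filter.1 hx).2
    simpa using ⟨t, ht⟩
  obtain ⟨t₀, -⟩ := hc 0 V.zero_mem
  have hpos := h t₀
  have hF : 0 < Nat.card F := Nat.card_pos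
  have h1 : Nat.card F ^ finrank F V ≤ Fintype.card τ * Nat.card F ^ (finrank F V - 1) := by
    rw [← hcard V]
    refine (card_le_card hsub).trans (card_biUnion_le_card_mul _ _ _ fun t _ => ?_)
    rw [hcard]
    exact Nat.pow_le_pow_right hF (by have := h t; omega)
  have h2 : Nat.card F ^ finrank F V = Nat.card F * Nat.card F ^ (finrank F V - 1) := by
    rw [← pow_succ', Nat.sub_add_cancel (by omega)]
  rw [h2] at h1
  exact absurd (Nat.le_of_mul_le_mul_right h1 (pow_pos hF _)) (by omega)

/-- Grown one vector at a time: a vector outside every `C ⊔ W t` preserves disjointness. -/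
theorem exists_submodule_finrank_eq_forall_disjoint [Nonempty τ] (V : Submodule F E)
    (W : τ → Submodule F E) (k : ℕ) (h : ∀ t, finrank F (W t) + k ≤ finrank F V)
    (hq : Fintype.card τ < Nat.card F) :
    ∃ C ≤ V, finrank F C = k ∧ ∀ t, Disjoint C (W t) := by
  induction k with
  | zero => exact ⟨⊥, bot_le, finrank_bot F E, fun t => disjoint_bot_left⟩
  | succ k ih =>
    obtain ⟨C, hCV, hCk, hd⟩ := ih fun t => by have := h t; omega
    obtain ⟨v, hvV, hv⟩ := exists_mem_forall_notMem_of_finrank_lt V (fun t => C ⊔ W t)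
      (fun t => by
        have h1 := Submodule.finrank_add_le_finrank_add_finrank C (W t)
        have h2 := h t
        omega) hq
    obtain ⟨t₀⟩ := ‹Nonempty τ›
    have hvC : v ∉ C := fun hc => hv t₀ (Submodule.mem_sup_left hc)
    have hv0 : v ≠ 0 := fun h0 => hvC (h0 ▸ C.zero_mem)
    refine ⟨C ⊔ F ∙ v, sup_le hCV ((Submodule.span_singleton_le_iff_mem _ _).2 hvV), ?_, ?_⟩
    · have h1 := Submodule.finrank_sup_add_finrank_inf_eq C (F ∙ v)
      have h2 : C ⊓ F ∙ v = ⊥ :=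
        disjoint_iff.1 ((Submodule.disjoint_span_singleton' hv0).2 hvC)
      rw [h2, finrank_bot, finrank_span_singleton hv0] at h1
      omega
    · intro t
      rw [Submodule.disjoint_def]
      intro x hx hxW
      obtain ⟨c, hc, y, hy, rfl⟩ := Submodule.mem_sup.1 hx
      obtain ⟨a, rfl⟩ := Submodule.mem_span_singleton.1 hy
      rcases eq_or_ne a 0 with rfl | ha
      · rw [zero_smul, add_zero] at hxW ⊢
        exact Submodule.disjoint_def.1 (hd t) c hc hxW
      · refine absurd ?_ (hv t)
        have : v = -(a⁻¹ • c) + a⁻¹ • (c + a • v) := by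
          rw [smul_add, inv_smul_smul₀ ha]; abel
        rw [this]
        exact Submodule.add_mem_sup (C.neg_mem (C.smul_mem _ hc)) ((W t).smul_mem _ hxW)

end Generic

/-! ### Parity-check kernels and the generic code inside them. -/

section Kernel

variable {F : Type*} [Field F] {ι κ : Type*} [Fintype ι]

/-- The code whose parity-check matrix has the columns `M c`. -/
def parityKer (M : ι → κ → F) : Submodule F (ι → F) :=
  LinearMap.ker (Fintype.linearCombination F M)

theorem mem_parityKer {M : ι → κ → F} {x : ι → F} :
    x ∈ parityKer M ↔ ∀ v, ∑ c, x c * M c v = 0 := by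
  simp [parityKer, Fintype.linearCombination_apply, funext_iff]

variable [Fintype κ]

theorem card_le_finrank_parityKer_add (M : ι → κ → F) :
    Fintype.card ι ≤ finrank F (parityKer M) + Fintype.card κ := by
  have h1 : _ + finrank F (parityKer M) = _ :=
    (Fintype.linearCombination F M).finrank_range_add_finrank_ker
  have h2 := Submodule.finrank_le (LinearMap.range (Fintype.linearCombination F M))
  rw [finrank_fintype_fun_eq_card] at h1 h2
  omega

/-- The row combinations of the matrix with columns `M c` supported inside `T`. -/
def rowsWithin (M : ι → κ → F) (T : Finset ι) : Submodule F (κ → F) where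
  carrier := {y | ∀ c ∉ T, M c ⬝ᵥ y = 0}
  add_mem' ha hb c hc := by rw [dotProduct_add, ha c hc, hb c hc, add_zero]
  zero_mem' c _ := dotProduct_zero _
  smul_mem' a y hy c hc := by rw [dotProduct_smul, hy c hc, smul_zero]

/-- Row rank equals column rank for the columns outside `T`: their linear relations are the kernel
words vanishing on `T`, and the vectors orthogonal to them form `rowsWithin M T`. -/
theorem finrank_vanishOn_parityKer_add_le [DecidableEq ι] (M : ι → κ → F) (T : Finset ι) :
    finrank F (vanishOn (parityKer M) T) + Fintype.card κ + #T ≤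
      Fintype.card ι + finrank F (rowsWithin M T) := by
  let A : Matrix {c // c ∉ T} κ F := Matrix.of fun c => M c
  have h1 := A.mulVecLin.finrank_range_add_finrank_ker
  have h2 := A.transpose.mulVecLin.finrank_range_add_finrank_ker
  have h3 : A.transpose.rank = A.rank := A.rank_transpose
  rw [Matrix.rank, Matrix.rank] at h3
  have h4 : finrank F (LinearMap.ker A.mulVecLin) ≤ finrank F (rowsWithin M T) := by
    apply Submodule.finrank_mono
    intro y hy c hc
    exact congrFun (LinearMap.mem_ker.1 hy) ⟨c, hc⟩
  have h5 : finrank F (vanishOn (parityKer M) T) ≤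
      finrank F (LinearMap.ker A.transpose.mulVecLin) := by
    let g : vanishOn (parityKer M) T →ₗ[F] ({c // c ∉ T} → F) :=
      LinearMap.pi fun c => (LinearMap.proj (c : ι)).comp (Submodule.subtype _)
    have hg : ∀ x, g x ∈ LinearMap.ker A.transpose.mulVecLin := by
      rintro ⟨x, hx⟩
      obtain ⟨hx, hxT⟩ := mem_vanishOn.1 hx
      rw [LinearMap.mem_ker]
      funext v
      have h := mem_parityKer.1 hx v
      rw [← sum_subset (subset_univ (Tᶜ)) fun c _ hc => by
        rw [hxT c (by simpa using hc), zero_mul]] at h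
      rw [sum_subtype (p := fun c => c ∉ T) Tᶜ (fun c => by simp) fun c => x c * M c v] at h
      exact (sum_congr rfl fun c _ => mul_comm _ _).trans h
    refine LinearMap.finrank_le_finrank_of_injective (f := g.codRestrict _ hg) ?_
    rw [← LinearMap.ker_eq_bot, LinearMap.ker_codRestrict, LinearMap.ker_eq_bot']
    rintro ⟨x, hx⟩ h
    obtain ⟨-, hxT⟩ := mem_vanishOn.1 hx
    ext c
    by_cases hc : c ∈ T
    · exact hxT c hc
    · exact congrFun h ⟨c, hc⟩
  rw [finrank_fintype_fun_eq_card] at h1 h2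
  have h6 : Fintype.card {c // c ∉ T} + #T = Fintype.card ι := by
    rw [Fintype.card_subtype_compl, Fintype.card_coe]
    have := card_le_univ T
    omega
  omega

end Kernel

theorem HasLocality.of_le_parityKer {F : Type} [Field F] {n r : ℕ} {κ : Type*} [Fintype κ]
    [DecidableEq F] {M : Fin n → κ → F} (hrow : ∀ v, #{c | M c v ≠ 0} ≤ r + 1)
    (hcol : ∀ c, ∃ v, M c v ≠ 0) {C : Submodule F (Fin n → F)} (hC : C ≤ parityKer M) :
    HasLocality C r := by
  intro i
  obtain ⟨v, hv⟩ := hcol i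
  have hi : i ∈ ({c | M c v ≠ 0} : Finset (Fin n)) := by simpa using hv
  refine ⟨({c | M c v ≠ 0} : Finset (Fin n)).erase i, notMem_erase _ _, ?_,
    fun j => -(M j v / M i v), fun c hc => ?_⟩
  · rw [card_erase_of_mem hi]
    have := hrow v
    omega
  · have h := mem_parityKer.1 (hC hc) v
    have h2 : ∑ j ∈ ({c | M c v ≠ 0} : Finset (Fin n)), c j * M j v = 0 := by
      refine (sum_subset (subset_univ _) fun j _ hj => ?_).trans h
      have : M j v = 0 := by simpa using hj
      rw [this, mul_zero]
    rw [← add_sum_erase _ _ hi] at h2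
    rw [eq_comm, ← mul_left_inj' hv, sum_mul, ← neg_eq_of_add_eq_zero_left h2, ← sum_neg_distrib]
    refine sum_congr rfl fun j _ => ?_
    field_simp

open Classical in
theorem exists_mem_card_eq_minDist {F : Type} [Field F] {n : ℕ} {C : Submodule F (Fin n → F)}
    (hC : C ≠ ⊥) :
    ∃ c ∈ C, c ≠ 0 ∧ ∃ T : Finset (Fin n), (∀ i ∈ T, c i = 0) ∧ minDist C + #T = n := by
  obtain ⟨c, hc, hc0⟩ := C.exists_mem_ne_zero_of_ne_bot hC
  obtain ⟨x, hx, y, hy, hxy, h⟩ :=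
    Nat.sInf_mem (s := {d | ∃ x ∈ C, ∃ y ∈ C, x ≠ y ∧ hammingDist x y = d})
      ⟨_, c, hc, 0, C.zero_mem, hc0, rfl⟩
  refine ⟨x - y, C.sub_mem hx hy, sub_ne_zero.2 hxy, ({i | x i = y i} : Finset (Fin n)),
    fun i hi => sub_eq_zero.2 (mem_filter.1 hi).2, ?_⟩
  have := card_filter_add_card_filter_not (s := (univ : Finset (Fin n))) (fun i => x i = y i)
  rw [card_univ, Fintype.card_fin] at this
  rw [minDist, ← h, hammingDist, add_comm]
  exact this

/-- If every subcode of dimension at least `k₁` of the row space has support at least `k + k₁`,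
then a generic `k`-dimensional subspace of the dual of the row space has minimum distance at least
`n - k - k₁ + 2`. -/
theorem exists_isLRC_le_minDist {F : Type} [Field F] [Finite F] [DecidableEq F] {n k l r : ℕ}
    {κ : Type*} [Fintype κ] (M : Fin n → κ → F) (hrow : ∀ v, #{c | M c v ≠ 0} ≤ r + 1)
    (hcol : ∀ c, ∃ v, M c v ≠ 0)
    (hM : ∀ T, l ≤ finrank F (rowsWithin M T) → k + l ≤ #T)
    (hk : 1 ≤ k) (hn : k + l ≤ n + 1) (hq : 2 ^ n < Nat.card F) :
    ∃ C : Submodule F (Fin n → F), IsLRC C k r ∧ n + 2 ≤ minDist C + k + l := by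
  classical
  -- Distance `n + 2 - k - l` means that no nonzero word vanishes on `k + l - 1` coordinates; there
  -- are at most `2 ^ n` such sets to avoid.
  let τ := {T : Finset (Fin n) // #T = k + l - 1}
  have hτ : Nonempty τ := by
    obtain ⟨T, -, hT⟩ := exists_subset_card_eq (s := (univ : Finset (Fin n)))
      (n := k + l - 1) (by rw [card_univ, Fintype.card_fin]; omega)
    exact ⟨⟨T, hT⟩⟩
  have hτq : Fintype.card τ < Nat.card F := by
    refine (Fintype.card_subtype_le _).trans_lt ?_
    simpa using hq
  obtain ⟨C, hC, hCk, hd⟩ := exists_submodule_finrank_eq_forall_disjoint (parityKer M)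
    (fun T : τ => vanishOn (parityKer M) T.1) k (fun T => by
      have h1 := card_le_finrank_parityKer_add M
      have h2 := finrank_vanishOn_parityKer_add_le M T.1
      have h3 : finrank F (rowsWithin M T.1) < l := by
        by_contra! h
        have := hM T.1 h
        have := T.2
        omega
      have := T.2
      omega) hτq
  refine ⟨C, ⟨hCk, .of_le_parityKer hrow hcol hC⟩, ?_⟩
  obtain ⟨c, hc, hc0, S, hS, hSc⟩ := exists_mem_card_eq_minDist (C := C) (by
    rintro rfl
    rw [finrank_bot] at hCk
    omega)
  by_contra! hlt
  obtain ⟨T, hT, hTc⟩ := exists_subset_card_eq (show k + l - 1 ≤ #S by omega)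
  exact hc0 <| Submodule.disjoint_def.1 (hd ⟨T, hTc⟩) _ hc <|
    mem_vanishOn.2 ⟨hC hc, fun i hi => hS i (hT hi)⟩

/-! ### The incidence matrix of a graph and its support sizes. -/

section Slots

variable {V : Type*} [DecidableEq V]

/-- The number of edges in `E` at the vertex `v`. -/
def edgeDeg (E : Finset (Sym2 V)) (v : V) : ℕ := #{e ∈ E | v ∈ e}

theorem edgeDeg_le_card (E : Finset (Sym2 V)) (v : V) : edgeDeg E v ≤ #E := card_filter_le _ _

theorem sum_edgeDeg_eq (E : Finset (Sym2 V)) (U : Finset V) :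
    ∑ v ∈ U, edgeDeg E v = ∑ e ∈ E, #{v ∈ U | v ∈ e} :=
  sum_card_bipartiteAbove_eq_sum_card_bipartiteBelow (fun (v : V) (e : Sym2 V) => v ∈ e)

theorem filter_mem_sym2_subset (U : Finset V) (i j : V) : {v ∈ U | v ∈ s(i, j)} ⊆ {i, j} := by
  intro v hv
  simpa using (mem_filter.1 hv).2

theorem sum_edgeDeg_le (E : Finset (Sym2 V)) (U : Finset V)
    [DecidablePred fun e : Sym2 V => ∃ v ∈ e, v ∈ U]
    [DecidablePred fun e : Sym2 V => ∀ v ∈ e, v ∈ U] :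
    ∑ v ∈ U, edgeDeg E v ≤ #{e ∈ E | ∃ v ∈ e, v ∈ U} + #{e ∈ E | ∀ v ∈ e, v ∈ U} := by
  rw [sum_edgeDeg_eq, card_filter, card_filter, ← sum_add_distrib]
  refine sum_le_sum fun e _ => ?_
  induction e with | _ i j
  have h2 : #{v ∈ U | v ∈ s(i, j)} ≤ 2 :=
    (card_le_card (filter_mem_sym2_subset U i j)).trans card_le_two
  by_cases hi : i ∈ U <;> by_cases hj : j ∈ U
  · simpa [hi, hj] using h2
  · have : {v ∈ U | v ∈ s(i, j)} ⊆ {i} := fun v hv => by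
      have := filter_mem_sym2_subset U i j hv
      have := (mem_filter.1 hv).1
      grind
    simpa [hi, hj] using card_le_card this
  · have : {v ∈ U | v ∈ s(i, j)} ⊆ {j} := fun v hv => by
      have := filter_mem_sym2_subset U i j hv
      have := (mem_filter.1 hv).1
      grind
    simpa [hi, hj] using card_le_card this
  · have : {v ∈ U | v ∈ s(i, j)} = ∅ := by
      rw [eq_empty_iff_forall_notMem]
      intro v hv
      have := filter_mem_sym2_subset U i j hv
      have := (mem_filter.1 hv).1
      grind
    rw [this, card_empty]
    exact Nat.zero_le _

theorem sum_univ_edgeDeg [Fintype V] {E : Finset (Sym2 V)} (hE : ∀ e ∈ E, ¬ e.IsDiag) :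
    ∑ v, edgeDeg E v = 2 * #E := by
  rw [sum_edgeDeg_eq, mul_comm, ← smul_eq_mul, ← sum_const]
  refine sum_congr rfl fun e he => ?_
  have := hE e he
  induction e with | _ i j
  have h : ({v | v ∈ s(i, j)} : Finset V) = {i, j} := by ext; simp
  rw [h, card_pair (by simpa using this)]

/-- Each vertex has `r + 1` slots, and the two ends of an edge share one of their slots. -/
abbrev Slot (E : Finset (Sym2 V)) (r : ℕ) : Type _ := (Σ v : V, Fin (r + 1 - edgeDeg E v)) ⊕ E

/-- The incidence vector of a slot. -/
def slotCol (F : Type*) [Field F] (E : Finset (Sym2 V)) (r : ℕ) : Slot E r → V → F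
  | .inl s => Pi.single s.1 1
  | .inr e => fun v => if v ∈ e.1 then 1 else 0

variable {F : Type*} [Field F] {E : Finset (Sym2 V)} {r : ℕ}

theorem exists_slotCol_ne_zero (c : Slot E r) : ∃ v, slotCol F E r c v ≠ 0 := by
  rcases c with s | ⟨e, he⟩
  · exact ⟨s.1, by simp [slotCol]⟩
  · induction e with | _ i j
    exact ⟨i, by simp [slotCol]⟩

variable [Fintype V]

theorem card_slotCol_ne_zero_le [DecidableEq F] (hr : #E ≤ r) (v : V) :
    #{c | slotCol F E r c v ≠ 0} ≤ r + 1 := by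
  have h1 := (edgeDeg_le_card E v).trans hr
  rw [card_filter, Fintype.sum_sum_type, Fintype.sum_sigma]
  have h2 : ∑ e : E, (if slotCol F E r (.inr e) v ≠ 0 then 1 else 0) = edgeDeg E v := by
    rw [edgeDeg, card_filter, ← sum_coe_sort E fun e => if v ∈ e then 1 else 0]
    exact sum_congr rfl fun e _ => by simp [slotCol]
  have h3 : ∑ u, ∑ i : Fin (r + 1 - edgeDeg E u),
      (if slotCol F E r (.inl ⟨u, i⟩) v ≠ 0 then 1 else 0) = r + 1 - edgeDeg E v := by
    rw [sum_eq_single_of_mem v (mem_univ v)]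
    · simp [slotCol]
    · intro u _ hu
      simp [slotCol, hu.symm]
  rw [h2, h3]
  omega

theorem card_slot_add_card (hE : ∀ e ∈ E, ¬ e.IsDiag) (hr : #E ≤ r) :
    Fintype.card (Slot E r) + #E = Fintype.card V * (r + 1) := by
  rw [Fintype.card_sum, Fintype.card_sigma, Fintype.card_coe]
  have h1 := sum_univ_edgeDeg hE
  have h2 : ∑ v, (r + 1 - edgeDeg E v) + ∑ v, edgeDeg E v = Fintype.card V * (r + 1) := by
    rw [← sum_add_distrib, ← smul_eq_mul, ← card_univ, ← sum_const]
    exact sum_congr rfl fun v _ => Nat.sub_add_cancel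
      (((edgeDeg_le_card E v).trans hr).trans r.le_succ)
  simp only [Fintype.card_fin]
  omega

theorem slotCol_inl_dotProduct (s : Σ v : V, Fin (r + 1 - edgeDeg E v)) (y : V → F) :
    slotCol F E r (.inl s) ⬝ᵥ y = y s.1 := by
  simp [slotCol]

theorem slotCol_inr_dotProduct {i j : V} (hij : i ≠ j) (he : s(i, j) ∈ E) (y : V → F) :
    slotCol F E r (.inr ⟨s(i, j), he⟩) ⬝ᵥ y = y i + y j := by
  have : slotCol F E r (.inr ⟨s(i, j), he⟩) = Pi.single i 1 + Pi.single j 1 := by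
    ext v
    simp only [slotCol, Sym2.mem_iff, Pi.add_apply, Pi.single_apply]
    grind
  rw [this, add_dotProduct]
  simp

/-- The sum of a vector over the ends of an edge vanishes on `D`. -/
def EdgeVanishes (D : Submodule F (V → F)) (e : Sym2 V) : Prop :=
  ∀ y ∈ D, ∀ i j, e = s(i, j) → y i + y j = 0

/-- On `D` the value at one end of `e` determines the other, so one coordinate of `U` is redundant.
-/
theorem finrank_add_one_le_card {D : Submodule F (V → F)} {U : Finset V}
    (hU : ∀ y ∈ D, ∀ v ∉ U, y v = 0) {e : Sym2 V} (he : ¬ e.IsDiag) (heU : ∀ v ∈ e, v ∈ U)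
    (hD : EdgeVanishes D e) : finrank F D + 1 ≤ #U := by
  induction e with | _ i j
  have hi : i ∈ U := heU i (by simp)
  have hij : i ≠ j := by simpa using he
  rw [← card_erase_add_one hi]
  refine Nat.add_le_add_right (finrank_le_card_of_forall_eq_zero D _ fun y hy h => ?_) 1
  have hv : ∀ v, v ≠ i → y v = 0 := fun v hv => by
    by_cases hvU : v ∈ U
    · exact h v (mem_erase.2 ⟨hv, hvU⟩)
    · exact hU y hy v hvU
  have hyi : y i = 0 := by simpa [hv j hij.symm] using hD y hy i j rfl
  funext v
  by_cases hvi : v = i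
  · exact hvi ▸ hyi
  · exact hv v hvi

/-- Distinct edges give independent conditions in every characteristic: each has an end (`i`, resp.
`a`) off the other edge, and both these coordinates are redundant. -/
theorem finrank_add_two_le_card {D : Submodule F (V → F)} {U : Finset V}
    (hU : ∀ y ∈ D, ∀ v ∉ U, y v = 0) {e e' : Sym2 V} (hne : e ≠ e') (he : ¬ e.IsDiag)
    (he' : ¬ e'.IsDiag) (heU : ∀ v ∈ e, v ∈ U) (heU' : ∀ v ∈ e', v ∈ U)
    (hD : EdgeVanishes D e) (hD' : EdgeVanishes D e') : finrank F D + 2 ≤ #U := by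
  obtain ⟨i, j, a, b, rfl, rfl, hij, hab, hia, hib, haj⟩ : ∃ i j a b, e = s(i, j) ∧ e' = s(a, b) ∧
      i ≠ j ∧ a ≠ b ∧ i ≠ a ∧ i ≠ b ∧ a ≠ j := by
    induction e with | _ i j
    induction e' with | _ a b
    simp only [Sym2.mk_isDiag_iff] at he he'
    have hne' : ¬ (i = a ∧ j = b ∨ i = b ∧ j = a) := by simpa using hne
    by_cases h1 : i ≠ a ∧ i ≠ b
    · by_cases h2 : a = j
      · exact ⟨i, j, b, a, rfl, Sym2.eq_swap, he, Ne.symm he', h1.2, h1.1,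
          fun h => he' (h2.trans h.symm)⟩
      · exact ⟨i, j, a, b, rfl, rfl, he, he', h1.1, h1.2, h2⟩
    · have h3 : j ≠ a ∧ j ≠ b := by grind
      by_cases h2 : a = i
      · exact ⟨j, i, b, a, Sym2.eq_swap, Sym2.eq_swap, Ne.symm he, Ne.symm he', h3.2, h3.1,
          fun h => he' (h2.trans h.symm)⟩
      · exact ⟨j, i, a, b, Sym2.eq_swap, rfl, Ne.symm he, he', h3.1, h3.2, h2⟩
  have hi : i ∈ U := heU i (by simp)
  have ha : a ∈ U.erase i := mem_erase.2 ⟨hia.symm, heU' a (by simp)⟩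
  rw [← card_erase_add_one hi, ← card_erase_add_one ha]
  refine Nat.add_le_add_right (finrank_le_card_of_forall_eq_zero D _ fun y hy h => ?_) 2
  have hv : ∀ v, v ≠ i → v ≠ a → y v = 0 := fun v hvi hva => by
    by_cases hvU : v ∈ U
    · exact h v (mem_erase.2 ⟨hva, mem_erase.2 ⟨hvi, hvU⟩⟩)
    · exact hU y hy v hvU
  have hyi : y i = 0 := by simpa [hv j hij.symm haj.symm] using hD y hy i j rfl
  have hya : y a = 0 := by simpa [hv b hib.symm hab.symm] using hD' y hy a b rfl
  funext v
  by_cases hvi : v = i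
  · exact hvi ▸ hyi
  by_cases hva : v = a
  · exact hva ▸ hya
  exact hv v hvi hva

open Classical in
-- `T` contains every slot where `D` is not identically zero: the unshared slots at `U` and the
-- edges meeting `U`, except edges inside `U` on which `D` vanishes. The first correction on the
-- right pays for edges inside `U` being counted at both ends, the second for the exceptions.
theorem card_mul_le_card_add (hE : ∀ e ∈ E, ¬ e.IsDiag) (hr : #E ≤ r) (T : Finset (Slot E r))
    {D : Submodule F (V → F)} (hD : D = rowsWithin (slotCol F E r) T) {U : Finset V}
    (hU : ∀ v, v ∈ U ↔ ∃ y ∈ D, y v ≠ 0) :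
    #U * (r + 1) ≤ #T + #{e ∈ E | ∀ v ∈ e, v ∈ U} +
      #{e ∈ E | (∀ v ∈ e, v ∈ U) ∧ EdgeVanishes D e} := by
  set A := {e ∈ E | (∀ v ∈ e, v ∈ U) ∧ EdgeVanishes D e} with hA
  set B := {e ∈ E | ∃ v ∈ e, v ∈ U} with hB
  have h1 : (U.sigma fun _ => univ).disjSum ((B \ A).subtype (· ∈ E)) ⊆ T := by
    rintro (s | ⟨e, he⟩) hc
    · rw [inl_mem_disjSum, mem_sigma] at hc
      obtain ⟨y, hy, hys⟩ := (hU _).1 hc.1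
      by_contra hT
      rw [hD] at hy
      exact hys ((slotCol_inl_dotProduct s y).symm.trans (hy _ hT))
    · rw [inr_mem_disjSum, mem_subtype, mem_sdiff] at hc
      by_contra hT
      have hv : EdgeVanishes D e := by
        rintro y hy i j rfl
        rw [hD] at hy
        exact (slotCol_inr_dotProduct (by simpa using hE _ he) he y).symm.trans (hy _ hT)
      refine hc.2 (mem_filter.2 ⟨he, ?_, hv⟩)
      obtain ⟨v, hve, hvU⟩ := (mem_filter.1 hc.1).2
      obtain ⟨y, hy, hyv⟩ := (hU _).1 hvU
      obtain ⟨w, rfl⟩ := Sym2.mem_iff_exists.1 hve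
      intro u hu
      rcases Sym2.mem_iff.1 hu with rfl | rfl
      · exact hvU
      · refine (hU u).2 ⟨y, hy, fun h0 => hyv ?_⟩
        simpa [h0] using hv y hy v u rfl
  have h2 := card_le_card h1
  have h3 : #((B \ A).subtype (· ∈ E)) = #(B \ A) := by
    rw [card_subtype, filter_true_of_mem]
    exact fun e he => (mem_filter.1 (mem_sdiff.1 he).1).1
  rw [card_disjSum, card_sigma, h3] at h2
  simp only [card_univ, Fintype.card_fin] at h2
  have h4 : #B ≤ #(B \ A) + #A := by
    have := le_card_sdiff A B
    omega
  have h5 : ∑ v ∈ U, (r + 1 - edgeDeg E v) + ∑ v ∈ U, edgeDeg E v = #U * (r + 1) := by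
    rw [← sum_add_distrib, ← smul_eq_mul, ← sum_const]
    exact sum_congr rfl fun v _ => Nat.sub_add_cancel
      (((edgeDeg_le_card E v).trans hr).trans r.le_succ)
  have h6 : _ ≤ #B + #{e ∈ E | ∀ v ∈ e, v ∈ U} := sum_edgeDeg_le E U
  omega

/-- The subcodes of dimension at least `l` of the row space of the incidence vectors have support
at least `l * (r + 1) - (l.choose 2 - 1)` when `E` has at most `r` edges and no `l`-clique. -/
theorem le_card_of_le_finrank_rowsWithin {k l : ℕ} (hE : ∀ e ∈ E, ¬ e.IsDiag) (hr : #E ≤ r)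
    (hl : 2 ≤ l) (hk : k + l.choose 2 = l * r + 1)
    (hcl : ∀ U : Finset V, #U = l → ∃ u ∈ U, ∃ v ∈ U, u ≠ v ∧ s(u, v) ∉ E)
    (T : Finset (Slot E r)) (hT : l ≤ finrank F (rowsWithin (slotCol F E r) T)) :
    k + l ≤ #T := by
  classical
  set D := rowsWithin (slotCol F E r) T with hD
  set U : Finset V := {v | ∃ y ∈ D, y v ≠ 0} with hUdef
  have hU : ∀ v, v ∈ U ↔ ∃ y ∈ D, y v ≠ 0 := fun v => by simp [hUdef]
  have hU' : ∀ y ∈ D, ∀ v ∉ U, y v = 0 := fun y hy v hv => by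
    by_contra h
    exact hv ((hU v).2 ⟨y, hy, h⟩)
  have hm := card_mul_le_card_add hE hr T hD hU
  set W := #{e ∈ E | ∀ v ∈ e, v ∈ U} with hW
  set A := {e ∈ E | (∀ v ∈ e, v ∈ U) ∧ EdgeVanishes D e} with hA
  have hlU : finrank F D ≤ #U := finrank_le_card_of_forall_eq_zero D U fun y hy h => funext fun v =>
    if hv : v ∈ U then h v hv else hU' y hy v hv
  have hWr : W ≤ r := (card_filter_le _ _).trans hr
  have hAr : #A ≤ r := (card_filter_le _ _).trans hr
  have hl2 : 1 ≤ l.choose 2 := Nat.choose_pos hl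
  have hlr : l * (r + 1) = l * r + l := by ring
  rcases (hT.trans hlU).eq_or_lt with h0 | h0
  -- `#U = l`: `D` is everything supported on `U`, so no edge vanishes on it, and the missing edge
  -- supplies the last unit.
  · have hA0 : #A = 0 := by
      rw [card_eq_zero, eq_empty_iff_forall_notMem]
      intro e he
      obtain ⟨he, heU, hv⟩ := mem_filter.1 he
      have := finrank_add_one_le_card hU' (hE e he) heU hv
      omega
    obtain ⟨u, hu, v, hv, huv, hne⟩ := hcl U h0.symm
    have hWl : W < l.choose 2 := by
      rw [h0, ← Sym2.card_image_offDiag]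
      refine card_lt_card ((ssubset_iff_of_subset ?_).2 ⟨s(u, v), ?_, ?_⟩)
      · intro e he
        obtain ⟨he, heU⟩ := mem_filter.1 he
        have := hE e he
        induction e with | _ i j
        exact mem_image.2 ⟨(i, j), mem_offDiag.2 ⟨heU i (by simp), heU j (by simp),
          by simpa using this⟩, rfl⟩
      · exact mem_image.2 ⟨(u, v), mem_offDiag.2 ⟨hu, hv, huv⟩, rfl⟩
      · exact fun h => hne (mem_filter.1 h).1
    rw [← h0, hlr] at hm
    omega
  · rcases (Nat.succ_le_of_lt h0).eq_or_lt with h1 | h1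
    -- `#U = l + 1`: `D` has codimension at most one, so at most one edge vanishes; with `W ≤ r` the
    -- corrections are absorbed by the extra vertex.
    · have hA1 : #A ≤ 1 := by
        rw [card_le_one]
        intro e he e' he'
        by_contra hne
        obtain ⟨he, heU, hv⟩ := mem_filter.1 he
        obtain ⟨he', heU', hv'⟩ := mem_filter.1 he'
        have := finrank_add_two_le_card hU' hne (hE e he) (hE e' he') heU heU' hv hv'
        omega
      rw [← h1, Nat.succ_mul, hlr] at hm
      omega
    -- `#U ≥ l + 2`: two extra vertices outweigh the corrections, at most `2 * r` in total.
    · have := Nat.mul_le_mul_right (r + 1) (Nat.succ_le_of_lt h1)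
      rw [Nat.succ_mul, Nat.succ_mul, hlr] at this
      omega

end Slots

/-! ### Arithmetic of the ceilings. -/

section Parameters

theorem natCast_k₁ (k r : ℕ) : (k₁ k r : ℤ) = ⌈(k : ℚ) / r⌉ :=
  Int.natCast_ceil_eq_ceil (by positivity)

theorem le_k₁_mul {k r : ℕ} (hr : 1 ≤ r) : k ≤ k₁ k r * r := by
  have h := Nat.le_ceil ((k : ℚ) / r)
  rw [div_le_iff₀ (by positivity)] at h
  exact_mod_cast h

theorem k₁_sub_one_mul_lt {k r : ℕ} (hr : 1 ≤ r) (hk : 1 ≤ k) : (k₁ k r - 1) * r < k := by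
  have hr' : (0 : ℚ) < r := by positivity
  have hpos : 0 < k₁ k r := Nat.ceil_pos.2 (by positivity)
  have h : ((k₁ k r - 1 : ℕ) : ℚ) < (k : ℚ) / r := Nat.lt_ceil.1 (Nat.sub_lt hpos one_pos)
  rw [lt_div_iff₀ hr'] at h
  exact_mod_cast h

theorem le_n₁_mul (n r : ℕ) : n ≤ n₁ n r * (r + 1) := by
  have h : (n : ℚ) / (r + 1) ≤ n₁ n r := Nat.le_ceil _
  rw [div_le_iff₀ (by positivity)] at h
  exact_mod_cast h

theorem n₁_mul_lt {n r : ℕ} (hn : 1 ≤ n) : n₁ n r * (r + 1) < n + (r + 1) := by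
  have hpos : 0 < n₁ n r := Nat.ceil_pos.2 (by positivity)
  have h : ((n₁ n r - 1 : ℕ) : ℚ) < (n : ℚ) / (r + 1) := Nat.lt_ceil.1 (Nat.sub_lt hpos one_pos)
  rw [lt_div_iff₀ (by positivity)] at h
  have h' : (n₁ n r - 1) * (r + 1) < n := by exact_mod_cast h
  obtain ⟨m, hm⟩ := Nat.exists_eq_add_of_lt hpos
  rw [hm] at h' ⊢
  simp only [zero_add, Nat.add_sub_cancel] at h' ⊢
  linarith

/-- The rate condition amounts to `k ≤ (n - k) * r`. -/
theorem add_k₁_le {n k r : ℕ} (hr : 1 ≤ r) (hkn : k < n)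
    (hrate : (k : ℚ) / n ≤ (r : ℚ) / (r + 1)) : k + k₁ k r ≤ n := by
  have hn' : (0 : ℚ) < n := by have : 0 < n := by omega
                               positivity
  rw [div_le_div_iff₀ hn' (by positivity)] at hrate
  have h : k * (r + 1) ≤ r * n := by exact_mod_cast hrate
  have h1 : k₁ k r ≤ n - k := by
    refine Nat.ceil_le.2 ?_
    rw [div_le_iff₀ (by positivity)]
    have h2 : k ≤ (n - k) * r := by
      rw [Nat.sub_mul]
      have : k * (r + 1) = k * r + k := by ring
      have : r * n = n * r := by ring
      omega
    exact_mod_cast h2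
  omega

end Parameters

/-! ### Codes from clique-free graphs. -/

section Existence

/-- A subset of the edges of the Turán graph with `p` parts contains no complete graph on `p + 1`
vertices. -/
theorem exists_edges_turanGraph {m p t : ℕ} (hp : 0 < p) (ht : t ≤ turanSize p m) :
    ∃ E : Finset (Sym2 (Fin m)), #E = t ∧ (∀ e ∈ E, ¬ e.IsDiag) ∧
      ∀ U : Finset (Fin m), #U = p + 1 → ∃ u ∈ U, ∃ v ∈ U, u ≠ v ∧ s(u, v) ∉ E := by
  obtain ⟨E, hE, hEt⟩ := exists_subset_card_eq ht
  refine ⟨E, hEt, fun e he => SimpleGraph.not_isDiag_of_mem_edgeFinset (hE he), fun U hU => ?_⟩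
  by_contra! h
  refine SimpleGraph.turanGraph_cliqueFree hp U ⟨fun u hu v hv huv => ?_, hU⟩
  exact SimpleGraph.mem_edgeFinset.1 (hE (h u hu v hv huv))

theorem rowsWithin_comp_equiv {F ι ι' κ : Type*} [Field F] [Fintype κ] (M : ι → κ → F)
    (e : ι' ≃ ι) (T : Finset ι') :
    rowsWithin (fun c => M (e c)) T = rowsWithin M (T.map e.toEmbedding) := by
  ext y
  refine ⟨fun h c hc => ?_, fun h c hc => ?_⟩
  · have := h (e.symm c) fun hT => hc (mem_map.2 ⟨_, hT, by simp⟩)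
    simpa using this
  · exact h (e c) (by simpa using hc)

theorem exists_isLRC_of_edges {n k l r m : ℕ} {E : Finset (Sym2 (Fin m))}
    (hE : ∀ e ∈ E, ¬ e.IsDiag) (hr : #E ≤ r) (hl : 2 ≤ l) (hk : 1 ≤ k)
    (hkl : k + l.choose 2 = l * r + 1)
    (hcl : ∀ U : Finset (Fin m), #U = l → ∃ u ∈ U, ∃ v ∈ U, u ≠ v ∧ s(u, v) ∉ E)
    (hn : n + #E = m * (r + 1)) (hkn : k + l ≤ n + 1) :
    ∃ (F : Type) (_ : Field F) (_ : Finite F) (C : Submodule F (Fin n → F)),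
      IsLRC C k r ∧ n + 2 ≤ minDist C + k + l := by
  obtain ⟨p, hp, hprime⟩ := Nat.exists_infinite_primes (2 ^ n + 1)
  have : Fact p.Prime := ⟨hprime⟩
  have hcard := card_slot_add_card (r := r) hE hr
  rw [Fintype.card_fin, ← hn] at hcard
  let e : Fin n ≃ Slot E r :=
    (Fintype.equivFinOfCardEq (Nat.add_right_cancel hcard)).symm
  refine ⟨ZMod p, inferInstance, inferInstance, ?_⟩
  refine exists_isLRC_le_minDist (fun c => slotCol (ZMod p) E r (e c)) (fun v => ?_)
    (fun c => exists_slotCol_ne_zero (e c)) (fun T hT => ?_) hk hkn ?_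
  · refine le_of_eq_of_le ?_ (card_slotCol_ne_zero_le (F := ZMod p) hr v)
    exact card_equiv e fun c => by simp
  · rw [rowsWithin_comp_equiv] at hT
    simpa using le_card_of_le_finrank_rowsWithin hE hr hl hkl hcl _ hT
  · rw [Nat.card_zmod]
    omega

end Existence

end LRC

theorem mainTheorem7 (n k r : ℕ) (hr : 1 ≤ r) (hrk : r ≤ k) (hkn : k < n)
    (hrate : (k : ℚ) / n ≤ (r : ℚ) / (r + 1))
    (hk₂ : LRC.k₂ k r = ((LRC.k₁ k r).choose 2 : ℤ) - 1)
    (hn₂ : LRC.n₂ n r ≤ (LRC.turanSize (LRC.k₁ k r - 1) (LRC.n₁ n r) : ℤ)) :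
    IsGreatest (LRC.lrcMinDists n k r) (LRC.largestMinDist n k r) ∧
      (LRC.largestMinDist n k r : ℤ) = LRC.dStar n k r := by
  have h1 := LRC.le_k₁_mul (k := k) hr
  have h2 := LRC.k₁_sub_one_mul_lt hr (hr.trans hrk)
  have h3 := LRC.le_n₁_mul n r
  have h4 := LRC.n₁_mul_lt (n := n) (r := r) (by omega)
  have h5 := LRC.add_k₁_le hr hkn hrate
  rw [LRC.k₂] at hk₂
  rw [LRC.n₂] at hn₂
  rw [LRC.dStar, ← LRC.natCast_k₁]
  generalize LRC.k₁ k r = l at *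
  generalize LRC.n₁ n r = m at *
  -- For `l < 2` the binomial is zero, forcing `k₂ = -1` against `k ≤ l * r`.
  have hl : 2 ≤ l := by
    by_contra! hl
    rw [Nat.choose_eq_zero_of_lt hl] at hk₂
    have : (k : ℤ) ≤ l * r := by exact_mod_cast h1
    omega
  have hkl : k + l.choose 2 = l * r + 1 := by
    zify
    linarith
  -- The number of edges is `n₂`, which `h4` bounds by `r`.
  obtain ⟨E, hEc, hE, hcl⟩ := LRC.exists_edges_turanGraph (m := m) (p := l - 1)
    (t := m * (r + 1) - n) (by omega) (by zify [h3]; exact hn₂)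
  rw [Nat.sub_add_cancel (by omega)] at hcl
  obtain ⟨F, hF, hF', C, hC, hd⟩ := LRC.exists_isLRC_of_edges (n := n) (k := k) (r := r) hE
    (by omega) hl (by omega) hkl hcl (by omega) (by omega)
  have hub : ∀ d ∈ LRC.lrcMinDists n k r, d + k + (l - 1) ≤ n + 1 := by
    rintro d ⟨F, _, _, C, hC, rfl⟩
    exact hC.minDist_add_le h2
  have hmem : LRC.minDist C ∈ LRC.lrcMinDists n k r := ⟨F, hF, hF', C, hC, rfl⟩
  have hgr : IsGreatest (LRC.lrcMinDists n k r) (LRC.minDist C) :=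
    ⟨hmem, fun d hd' => by have := hub d hd'; omega⟩
  have heq : LRC.largestMinDist n k r = LRC.minDist C := hgr.csSup_eq
  rw [heq]
  have := hub _ hmem
  exact ⟨hgr, by omega⟩
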